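/- Let $M\cong\mathbb Z^d$ be a lattice, $N=\mathrm{Hom}(M,\mathbb Z)$ its dual, and $M_{\mathbb R}=M\otimes\mathbb R$, $N_{\mathbb R}=N\otimes\mathbb R$, so $\dim M_{\mathbb R}=d$. A lattice polytope is the convex hull of finitely many lattice points. A lattice polytope $\Delta\subset M_{\mathbb R}$ with $0$ in its interior is reflexive if $\Delta^*=\{y\in N_{\mathbb R} : \langle y,x\rangle\ge -1\ \forall x\in\Delta\}$ is a lattice polytope with respect to $N$; a lattice polytope $\Delta$ with a unique interior lattice point $m$ is called reflexive (with respect to $m$) if $\Delta-m$ is reflexive. A nef-partition of length $r\ge 1$ is a family of lattice polytopes $\Delta_1,\dots,\Delta_r\subset M_{\mathbb R}$ whose Minkowski sum $\Delta=\Delta_1+\cdots+\Delta_r$ is reflexive with respect to its unique interior lattice point $m$, and for which there exist lattice points $p_i\in\Delta_i$ with $p_1+\cdots+p_r=m$. It is proper if $\dim\Delta_i>0$ for all $i$, and centered if one can take $p_i=0$ for all $i$. Proposition. Let $\Delta_1,\dots,\Delta_r$ be a proper nef-partition in $M_{\mathbb R}$. Then $r\le 2d$. Moreover, if $r=2d$,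 then for every choice of lattice points $p_i\in\Delta_i$ with $p_1+\cdots+p_r=m$ the polytope $\mathrm{Conv}\bigl((\Delta_1-p_1)\cup\cdots\cup(\Delta_r-p_r)\bigr)$ is combinatorially equivalent to the $d$-dimensional crosspolytope (the dual of the $d$-cube), i.e. their face lattices are isomorphic. In particular, for a centered proper nef-partition with $r=2d$, $\mathrm{Conv}(\Delta_1,\dots,\Delta_r)$ is combinatorially a $d$-dimensional crosspolytope. -/

import Mathlib

open scoped Pointwise

namespace Nef

/-- A lattice polytope: the convex hull of finitely many points of the lattice `L`. -/
def IsLatticePolytope {E : Type*} [AddCommGroup E] [Module ℝ E]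
    (L : Submodule ℤ E) (P : Set E) : Prop :=
  ∃ S : Set E, S.Finite ∧ S ⊆ (L : Set E) ∧ P = convexHull ℝ S

/-- The dimension of a polytope, i.e. of its affine hull. -/
noncomputable def polytopeDim {E : Type*} [AddCommGroup E] [Module ℝ E] (P : Set E) : ℕ :=
  Module.finrank ℝ (affineSpan ℝ P).direction

/-- The dual lattice: the linear forms that take integral values on `L`. -/
def dualLattice {E : Type*} [AddCommGroup E] [Module ℝ E] (L : Submodule ℤ E) :
    Submodule ℤ (Module.Dual ℝ E) where
  carrier := {y | ∀ x ∈ L, ∃ n : ℤ, y x = n}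
  zero_mem' := fun _ _ => ⟨0, by simp⟩
  add_mem' := by
    intro y z hy hz x hx
    obtain ⟨a, ha⟩ := hy x hx
    obtain ⟨b, hb⟩ := hz x hx
    exact ⟨a + b, by simp [ha, hb]⟩
  smul_mem' := by
    intro c y hy x hx
    obtain ⟨a, ha⟩ := hy x hx
    exact ⟨c * a, by simp [ha]⟩

/-- The dual polytope `{y | ⟨y, x⟩ ≥ -1 for all x ∈ P}`. -/
def dualPolytope {E : Type*} [AddCommGroup E] [Module ℝ E] (P : Set E) :
    Set (Module.Dual ℝ E) :=
  {y | ∀ x ∈ P, -1 ≤ y x}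

/-- A reflexive polytope (with respect to the origin). -/
structure IsReflexive {E : Type*} [NormedAddCommGroup E] [NormedSpace ℝ E]
    (L : Submodule ℤ E) (P : Set E) : Prop where
  lattice : IsLatticePolytope L P
  zero_mem_interior : (0 : E) ∈ interior P
  lattice_dual : IsLatticePolytope (dualLattice L) (dualPolytope P)

/-- `P` has `m` as its only interior lattice point and `P - m` is reflexive. -/
structure IsReflexiveAt {E : Type*} [NormedAddCommGroup E] [NormedSpace ℝ E]
    (L : Submodule ℤ E) (P : Set E) (m : E) : Prop where
  interior_inter : interior P ∩ (L : Set E) = {m}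
  reflexive : IsReflexive L ((fun x => x - m) '' P)

/-- The lattice polytopes `Δ 0, …, Δ (r - 1)`, `r ≥ 1`, form a nef-partition, as witnessed by the
lattice points `p i ∈ Δ i`: their Minkowski sum is a reflexive polytope whose interior lattice
point is `∑ i, p i`. -/
structure IsNefPartitionAt {E : Type*} [NormedAddCommGroup E] [NormedSpace ℝ E]
    (L : Submodule ℤ E) {r : ℕ} (Δ : Fin r → Set E) (p : Fin r → E) : Prop where
  length_pos : 0 < r
  lattice : ∀ i, IsLatticePolytope L (Δ i)
  mem : ∀ i, p i ∈ Δ i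
  mem_lattice : ∀ i, p i ∈ L
  reflexive : IsReflexiveAt L (∑ i, Δ i) (∑ i, p i)

/-- A nef-partition of length `r`. -/
def IsNefPartition {E : Type*} [NormedAddCommGroup E] [NormedSpace ℝ E]
    (L : Submodule ℤ E) {r : ℕ} (Δ : Fin r → Set E) : Prop :=
  ∃ p : Fin r → E, IsNefPartitionAt L Δ p

/-- All members of the family have positive dimension. -/
def IsProper {E : Type*} [AddCommGroup E] [Module ℝ E] {r : ℕ} (Δ : Fin r → Set E) : Prop :=
  ∀ i, 0 < polytopeDim (Δ i)

/-- The faces of a polytope (including the empty face and the polytope itself), ordered by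
inclusion. -/
abbrev Faces {E : Type*} [AddCommGroup E] [Module ℝ E] [TopologicalSpace E] (P : Set E) : Type _ :=
  {F : Set E // IsExposed ℝ P F}

/-- Two polytopes are combinatorially equivalent if their face lattices are isomorphic. -/
def CombEquiv {E F : Type*} [AddCommGroup E] [Module ℝ E] [TopologicalSpace E]
    [AddCommGroup F] [Module ℝ F] [TopologicalSpace F] (P : Set E) (Q : Set F) : Prop :=
  Nonempty (Faces P ≃o Faces Q)

/-- The standard `d`-dimensional crosspolytope, the dual of the cube `[-1, 1]^d`. -/
def crossPolytope (d : ℕ) : Set (Fin d → ℝ) :=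
  {x | ∑ i, |x i| ≤ 1}

end Nef

/-! Translate each summand to `X i = Δ i - p i`, which contains 0. The dual of the translated
Minkowski sum is the convex hull of a set `V` of integral linear forms, each at least -1 on the sum.
An integral form that is negative somewhere on `X i` takes a value at most -1 there. Were this so
for two summands, adding two such points would give a value at most -2 on the sum. Hence each form
in `V` is negative on at most one summand. Since `V` separates nonzero points from 0 and every `X i`
has a nonzero point, each `i` gets a form `v i` that is negative somewhere on `X i` and nonnegative
on all other summands (`IsNefPartitionAt.exists_isIrredundant`).

The `X i` together positively span the space. A positively spanning subset `T` of their union must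
contain, for each `i`, a point of `X i` where `v i` is negative, and these points are distinct; so
`r ≤ |T|`. Steinitz's bound `|T| ≤ 2d` for a suitable `T` gives `r ≤ 2d`.

If `r = 2d`, such a `T` is a minimal positively spanning set of maximal size, hence consists of a
basis and negative multiples of its members (`IsExtremalPositiveBasis.exists_opposite`). The forms
`v i` are then multiples of the coordinates, which forces every `X i` onto a half-axis. The convex
hull is a crosspolytope with unequal semi-axes, whose proper faces are indexed by sign vectors;
rescaling the half-axes gives the standard one. -/

namespace Nef

/-! ### Positive spanning sets and the extremal case of Steinitz's bound. -/

section PositiveSpanning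

variable {E : Type*} [AddCommGroup E] [Module ℝ E]

/-- Carathéodory's theorem for cones. -/
theorem exists_linearIndepOn_pos_combination (t : Finset E) (c : E → ℝ) (hc : ∀ x ∈ t, 0 ≤ c x) :
    ∃ s ⊆ t, LinearIndepOn ℝ id (s : Set E) ∧
      ∃ a : E → ℝ, (∀ x ∈ s, 0 < a x) ∧ ∑ x ∈ s, a x • x = ∑ x ∈ t, c x • x := by
  classical
  induction t using Finset.strongInduction generalizing c with
  | H t ih =>
  have reduce : ∀ e : E → ℝ, (∀ x ∈ t, 0 ≤ e x) → (∃ x ∈ t, e x = 0) →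
      ∑ x ∈ t, e x • x = ∑ x ∈ t, c x • x →
      ∃ s ⊆ t, LinearIndepOn ℝ id (s : Set E) ∧
        ∃ a : E → ℝ, (∀ x ∈ s, 0 < a x) ∧ ∑ x ∈ s, a x • x = ∑ x ∈ t, c x • x := by
    rintro e he ⟨x₀, hx₀, hx₀'⟩ hsum
    obtain ⟨s, hs, hli, a, ha, has⟩ := ih (t.erase x₀) (Finset.erase_ssubset hx₀) e
      fun x hx => he x (Finset.mem_of_mem_erase hx)
    refine ⟨s, hs.trans (Finset.erase_subset _ _), hli, a, ha, ?_⟩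
    rw [has, ← hsum, ← Finset.add_sum_erase t _ hx₀, hx₀', zero_smul, zero_add]
  by_cases hpos : ∃ x ∈ t, c x = 0
  · exact reduce c hc hpos rfl
  have hcpos : ∀ x ∈ t, 0 < c x := fun x hx =>
    lt_of_le_of_ne (hc x hx) fun h => hpos ⟨x, hx, h.symm⟩
  by_cases hli : LinearIndepOn ℝ id (t : Set E)
  · exact ⟨t, subset_rfl, hli, c, hcpos, rfl⟩
  obtain ⟨g, hg, x₁, hx₁, hx₁'⟩ : ∃ g : E → ℝ, ∑ x ∈ t, g x • x = 0 ∧ ∃ x ∈ t, 0 < g x := by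
    rw [linearIndepOn_finset_iff] at hli
    push Not at hli
    obtain ⟨g, hg, x, hx, hne⟩ := hli
    rcases hne.lt_or_gt with h | h
    · exact ⟨fun y => - g y, by simpa using hg, x, hx, by simpa using h⟩
    · exact ⟨g, by simpa using hg, x, hx, h⟩
  -- The smallest ratio `c x / g x` is the largest multiple of the relation `g` that can be
  -- subtracted while all coefficients stay nonnegative; the coefficient of `x₀` becomes zero.
  obtain ⟨x₀, hx₀, hmin⟩ := Finset.exists_min_image (t.filter fun x => 0 < g x)
    (fun x => c x / g x) ⟨x₁, by simp [hx₁, hx₁']⟩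
  simp only [Finset.mem_filter] at hx₀ hmin
  have hq : 0 ≤ c x₀ / g x₀ := div_nonneg (hc _ hx₀.1) hx₀.2.le
  refine reduce (fun x => c x - c x₀ / g x₀ * g x) (fun x hx => ?_) ⟨x₀, hx₀.1, ?_⟩ ?_
  · rcases lt_or_ge 0 (g x) with h | h
    · have := hmin x ⟨hx, h⟩
      rw [le_div_iff₀ h] at this
      linarith
    · have := mul_nonpos_of_nonneg_of_nonpos hq h
      linarith [hc x hx]
  · have := hx₀.2.ne'
    field_simp
    ring
  · simp only [sub_smul, mul_smul, Finset.sum_sub_distrib, ← Finset.smul_sum, hg, smul_zero,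
      sub_zero]

theorem exists_linearIndepOn_of_mem_hull {X : Set E} {z : E} (hz : z ∈ PointedCone.hull ℝ X) :
    ∃ s : Finset E, (s : Set E) ⊆ X ∧ LinearIndepOn ℝ id (s : Set E) ∧
      ∃ a : E → ℝ, (∀ x ∈ s, 0 < a x) ∧ ∑ x ∈ s, a x • x = z := by
  rw [PointedCone.mem_hull_set] at hz
  obtain ⟨c, hcX, hc, hsum⟩ := hz
  obtain ⟨s, hs, hli, a, ha, has⟩ :=
    exists_linearIndepOn_pos_combination c.support c fun x _ => hc x
  refine ⟨s, fun x hx => hcX (hs hx), hli, a, ha, ?_⟩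
  rw [has, ← hsum, Finsupp.sum]

theorem sum_smul_mem_hull {ι : Type*} {s : Finset ι} {X : Set E} {a : ι → ℝ} {x : ι → E}
    (ha : ∀ i ∈ s, 0 ≤ a i) (hx : ∀ i ∈ s, x i ∈ X) :
    ∑ i ∈ s, a i • x i ∈ PointedCone.hull ℝ X :=
  Submodule.sum_mem _ fun i hi =>
    PointedCone.smul_mem _ (ha i hi) (PointedCone.subset_hull (hx i hi))

/-- Adjoining to a linear spanning set the opposite of a positive combination of its members makes
it positively spanning. -/
theorem hull_eq_top_of_neg_sum_mem {D : Finset E} (hD : Submodule.span ℝ (D : Set E) = ⊤)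
    {w : E → ℝ} (hw : ∀ x ∈ D, 0 < w x) {K : PointedCone ℝ E} (hDK : (D : Set E) ⊆ K)
    (hK : -∑ x ∈ D, w x • x ∈ K) : K = ⊤ := by
  classical
  have h : (D : Set E) ⊆ K.lineal := by
    intro x hx
    refine PointedCone.mem_lineal.2 ⟨hDK hx, ?_⟩
    have hwx := hw x hx
    have : -x = (w x)⁻¹ • (-∑ x ∈ D, w x • x + ∑ y ∈ D.erase x, w y • y) := by
      rw [← Finset.add_sum_erase D _ hx, neg_add, add_assoc, neg_add_cancel, add_zero, smul_neg,
        inv_smul_smul₀ hwx.ne']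
    rw [this]
    refine PointedCone.smul_mem _ (inv_nonneg.2 hwx.le) (Submodule.add_mem _ hK ?_)
    refine Submodule.sum_mem _ fun y hy => ?_
    have hy := Finset.mem_of_mem_erase hy
    exact PointedCone.smul_mem _ (hw y hy).le (hDK hy)
  have h2 : K.lineal = ⊤ := top_le_iff.1 (hD ▸ Submodule.span_le.2 h)
  refine top_le_iff.1 fun x _ => ?_
  have : x ∈ K.lineal := h2 ▸ Submodule.mem_top
  exact (PointedCone.mem_lineal.1 this).1

/-- Carathéodory's theorem applied to the opposite of a positive combination of `D` yields `C`. The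
weights `w` are left free, since varying them later controls the signs of coordinates. -/
theorem exists_positive_complement {X : Set E} (hX : PointedCone.hull ℝ X = ⊤) {D : Finset E}
    (hD : Submodule.span ℝ (D : Set E) = ⊤) {w : E → ℝ} (hw : ∀ x ∈ D, 0 < w x) :
    ∃ C : Finset E, (C : Set E) ⊆ X ∧ LinearIndepOn ℝ id (C : Set E) ∧
      (∃ a : E → ℝ, (∀ x ∈ C, 0 < a x) ∧ ∑ x ∈ C, a x • x = -∑ x ∈ D, w x • x) ∧
      PointedCone.hull ℝ ((D : Set E) ∪ C) = ⊤ := by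
  obtain ⟨C, hCX, hC, a, ha, hsum⟩ :=
    exists_linearIndepOn_of_mem_hull (X := X) (z := -∑ x ∈ D, w x • x) (hX ▸ Submodule.mem_top)
  refine ⟨C, hCX, hC, ⟨a, ha, hsum⟩, hull_eq_top_of_neg_sum_mem hD hw ?_ ?_⟩
  · exact Set.subset_union_left.trans PointedCone.subset_hull
  · rw [← hsum]
    exact sum_smul_mem_hull (fun x hx => (ha x hx).le) fun x hx => Or.inr hx

theorem span_eq_top_of_hull_eq_top {X : Set E} (hX : PointedCone.hull ℝ X = ⊤) :
    Submodule.span ℝ X = ⊤ :=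
  top_le_iff.1 fun _ _ => PointedCone.hull_le_span ℝ X (hX ▸ Submodule.mem_top)

theorem exists_dual_family {C : Finset E} (hli : LinearIndepOn ℝ id (C : Set E))
    (hC : Submodule.span ℝ (C : Set E) = ⊤) :
    ∃ f : E → Module.Dual ℝ E, (∀ x ∈ C, f x x = 1) ∧
      (∀ x ∈ C, ∀ y ∈ C, x ≠ y → f x y = 0) ∧ ∀ z, ∑ x ∈ C, f x z • x = z := by
  classical
  have hli' : LinearIndependent ℝ (fun x : C => (x : E)) := hli
  let b := Module.Basis.mk hli' (by rw [Subtype.range_coe_subtype]; exact hC.ge)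
  have hb : ∀ x : C, b x = x := fun x => by simp [b]
  refine ⟨fun x => if hx : x ∈ C then b.coord ⟨x, hx⟩ else 0, fun x hx => ?_,
    fun x hx y hy hxy => ?_, fun z => ?_⟩
  · have := b.repr_self ⟨x, hx⟩
    rw [hb] at this
    simp [hx, this]
  · have := b.repr_self ⟨y, hy⟩
    rw [hb] at this
    simp [hx, this, hxy.symm]
  · rw [← Finset.sum_coe_sort]
    conv_rhs => rw [← b.sum_repr z]
    exact Finset.sum_congr rfl fun x _ => by simp [hb]

variable [FiniteDimensional ℝ E]

theorem exists_basis_finset_subset {X : Set E} (hX : Submodule.span ℝ X = ⊤) :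
    ∃ D : Finset E, (D : Set E) ⊆ X ∧ Submodule.span ℝ (D : Set E) = ⊤ ∧
      LinearIndepOn ℝ id (D : Set E) ∧ D.card = Module.finrank ℝ E := by
  obtain ⟨b, hbX, hb, hli⟩ := exists_linearIndependent ℝ X
  have hfin : b.Finite := hli.setFinite
  lift b to Finset E using hfin
  refine ⟨b, hbX, hb.trans hX, hli, ?_⟩
  have := finrank_span_finset_eq_card (R := ℝ) (s := b) hli
  rw [← this, hb, hX, finrank_top]

theorem card_le_finrank_of_linearIndepOn {C : Finset E} (hC : LinearIndepOn ℝ id (C : Set E)) :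
    C.card ≤ Module.finrank ℝ E := by
  have := finrank_span_finset_eq_card (R := ℝ) (s := C) hC
  rw [← this]
  exact Submodule.finrank_le _

/-- A positively spanning set contains a positively spanning set of at most `2 d` elements. -/
theorem exists_small_positively_spanning {X : Set E} (hX : PointedCone.hull ℝ X = ⊤) :
    ∃ B : Finset E, (B : Set E) ⊆ X ∧ PointedCone.hull ℝ (B : Set E) = ⊤ ∧
      B.card ≤ 2 * Module.finrank ℝ E := by
  classical
  obtain ⟨D, hDX, hD, -, hDc⟩ := exists_basis_finset_subset (span_eq_top_of_hull_eq_top hX)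
  obtain ⟨C, hCX, hC, -, htop⟩ := exists_positive_complement hX hD (w := 1) (by simp)
  refine ⟨D ∪ C, by simp [hDX, hCX], by simpa using htop, ?_⟩
  have := Finset.card_union_le D C
  have := card_le_finrank_of_linearIndepOn hC
  omega

/-- The finite set `B` is a minimal positively spanning set of maximal size. -/
structure IsExtremalPositiveBasis (B : Finset E) : Prop where
  hull_eq_top : PointedCone.hull ℝ (B : Set E) = ⊤
  minimal : ∀ T ⊆ B, PointedCone.hull ℝ (T : Set E) = ⊤ → T = B
  card_eq : B.card = 2 * Module.finrank ℝ E

namespace IsExtremalPositiveBasis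

variable [DecidableEq E] {B D : Finset E}

/-- Minimality forces `D ∪ C = B` for the complement `C` of `D`, and `C` has at most `d` elements by
independence. As `B \ D` already has `d`, it equals `C`, whatever the weights. -/
theorem exists_sum_sdiff (hB : IsExtremalPositiveBasis B) (hDB : D ⊆ B)
    (hD : Submodule.span ℝ (D : Set E) = ⊤) (hDc : D.card = Module.finrank ℝ E)
    {w : E → ℝ} (hw : ∀ x ∈ D, 0 < w x) :
    LinearIndepOn ℝ id ((B \ D : Finset E) : Set E) ∧
      ∃ a : E → ℝ, (∀ x ∈ B \ D, 0 < a x) ∧ ∑ x ∈ B \ D, a x • x = -∑ x ∈ D, w x • x := by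
  obtain ⟨C, hCB, hC, ha, htop⟩ := exists_positive_complement hB.hull_eq_top hD hw
  have hU : D ∪ C = B := hB.minimal _ (Finset.union_subset hDB (by exact_mod_cast hCB))
    (by simpa using htop)
  have hsub : B \ D ⊆ C := by
    rw [← hU]; intro x; simp only [Finset.mem_sdiff, Finset.mem_union]; tauto
  have hcard : C.card ≤ (B \ D).card := by
    rw [Finset.card_sdiff_of_subset hDB, hB.card_eq, hDc]
    have := card_le_finrank_of_linearIndepOn hC
    omega
  have : B \ D = C := Finset.eq_of_subset_of_card_le hsub hcard
  rw [this]
  exact ⟨hC, ha⟩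

theorem span_sdiff (hB : IsExtremalPositiveBasis B) (hDB : D ⊆ B)
    (hD : Submodule.span ℝ (D : Set E) = ⊤) (hDc : D.card = Module.finrank ℝ E) :
    Submodule.span ℝ ((B \ D : Finset E) : Set E) = ⊤ := by
  have hli := (hB.exists_sum_sdiff hDB hD hDc (w := 1) (by simp)).1
  apply Submodule.eq_top_of_finrank_eq
  rw [finrank_span_finset_eq_card hli, Finset.card_sdiff_of_subset hDB, hB.card_eq, hDc]
  omega

/-- The opposite of a member of a basis `D ⊆ B` has nonnegative coordinates in `B \ D`. -/
theorem coord_neg_nonneg (hB : IsExtremalPositiveBasis B) (hDB : D ⊆ B)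
    (hD : Submodule.span ℝ (D : Set E) = ⊤) (hDc : D.card = Module.finrank ℝ E)
    {y : E} (hy : y ∈ B \ D) {g : Module.Dual ℝ E} (hgy : g y = 1)
    (hg : ∀ z ∈ B \ D, y ≠ z → g z = 0) {x : E} (hx : x ∈ D) : 0 ≤ g (-x) := by
  by_contra! hneg
  set e := g (-∑ z ∈ D, z)
  set q := g (-x)
  -- Giving `x` weight `t` and all others weight 1, the `y`-coordinate of the opposite sum stays
  -- positive. It is affine in `t` with slope `q`, so large `t` rules out `q < 0`.
  have key : ∀ t : ℝ, 0 < t → 0 < e + (t - 1) * q := by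
    intro t ht
    obtain ⟨-, a, ha, hsum⟩ := hB.exists_sum_sdiff hDB hD hDc
      (w := fun z => if z = x then t else 1) (fun z _ => by split_ifs <;> linarith)
    have h1 : ∑ z ∈ D, (if z = x then t else (1 : ℝ)) • z = ∑ z ∈ D, z + (t - 1) • x := by
      rw [← Finset.add_sum_erase D _ hx, ← Finset.add_sum_erase D (fun z => z) hx]
      have : ∑ z ∈ D.erase x, (if z = x then t else (1 : ℝ)) • z = ∑ z ∈ D.erase x, z :=
        Finset.sum_congr rfl fun z hz => by simp [Finset.ne_of_mem_erase hz]
      rw [this, if_pos rfl]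
      module
    have h2 : g (∑ z ∈ B \ D, a z • z) = a y := by
      rw [map_sum, Finset.sum_eq_single_of_mem y hy fun z hz hzy => by simp [hg z hz hzy.symm]]
      simp [hgy]
    rw [hsum, h1] at h2
    have h3 : e + (t - 1) * q = a y := by
      rw [← h2]; simp only [e, q, map_neg, map_add, map_smul, smul_eq_mul]; ring
    rw [h3]
    exact ha y hy
  have h := key (1 + (|e| + 1) / (-q)) (by have : 0 < -q := by linarith
                                           positivity)
  have : (1 + (|e| + 1) / (-q) - 1) * q = -(|e| + 1) := by
    field_simp [hneg.ne]
    ring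
  rw [this] at h
  linarith [le_abs_self e]

/-- A minimal positively spanning set of maximal size consists of opposite pairs. -/
theorem exists_opposite_of_mem (hB : IsExtremalPositiveBasis B) (hDB : D ⊆ B)
    (hD : Submodule.span ℝ (D : Set E) = ⊤) (hDc : D.card = Module.finrank ℝ E)
    (hDli : LinearIndepOn ℝ id (D : Set E)) {x : E} (hx : x ∈ D) :
    ∃ c : ℝ, 0 < c ∧ -(c • x) ∈ B := by
  have hC := hB.span_sdiff hDB hD hDc
  have hCli := (hB.exists_sum_sdiff hDB hD hDc (w := 1) (by simp)).1
  have hCB : B \ D ⊆ B := Finset.sdiff_subset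
  have hCc : (B \ D).card = Module.finrank ℝ E := by
    rw [Finset.card_sdiff_of_subset hDB, hB.card_eq, hDc]; omega
  have hDD : B \ (B \ D) = D := Finset.sdiff_sdiff_eq_self hDB
  obtain ⟨f, hf1, hf0, hf⟩ := exists_dual_family hDli hD
  obtain ⟨g, hg1, hg0, hg⟩ := exists_dual_family hCli hC
  have hfn : ∀ k ∈ D, ∀ y ∈ B \ D, 0 ≤ f k (-y) := fun k hk y hy =>
    hB.coord_neg_nonneg hCB hC hCc (by rwa [hDD]) (hf1 k hk)
      (fun z hz => hf0 k hk z (by rwa [hDD] at hz)) hy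
  have hgn : ∀ y ∈ B \ D, 0 ≤ g y (-x) := fun y hy =>
    hB.coord_neg_nonneg hDB hD hDc hy (hg1 y hy) (hg0 y hy) hx
  have hx0 : x ≠ 0 := fun h => by have := hf1 x hx; rw [h, map_zero] at this; simp at this
  obtain ⟨y, hy, hypos⟩ : ∃ y ∈ B \ D, 0 < g y (-x) := by
    by_contra! h
    have := hg (-x)
    rw [Finset.sum_eq_zero fun y hy => by rw [le_antisymm (h y hy) (hgn y hy), zero_smul]] at this
    exact hx0 (neg_eq_zero.1 this.symm)
  -- Expand `-x` in the basis `B \ D` and take the `k`-th coordinate in `D`: a sum of products of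
  -- nonnegative numbers vanishes. As `y` occurs with positive coefficient, its own `k`-th
  -- coordinate is 0, so `y` is a multiple of `x`.
  have hzero : ∀ k ∈ D, k ≠ x → f k (-y) = 0 := by
    intro k hk hkx
    have h1 : ∑ z ∈ B \ D, g z (-x) * f k (-z) = 0 := by
      have h2 := congrArg (f k) (hg (-x))
      simp only [map_sum, map_smul, smul_eq_mul] at h2
      rw [map_neg (f k), hf0 k hk x hx hkx] at h2
      simpa using h2
    have h2 := (Finset.sum_eq_zero_iff_of_nonneg fun z hz =>
      mul_nonneg (hgn z hz) (hfn k hk z hz)).1 h1 y hy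
    exact (mul_eq_zero.1 h2).resolve_left hypos.ne'
  have hyx : f x (-y) • x = -y := by
    conv_rhs => rw [← hf (-y)]
    rw [Finset.sum_eq_single_of_mem x hx fun k hk hkx => by rw [hzero k hk hkx, zero_smul]]
  have hy0 : y ≠ 0 := fun h => by have := hg1 y hy; rw [h, map_zero] at this; simp at this
  refine ⟨f x (-y), lt_of_le_of_ne (hfn x hx y hy) fun h => ?_, ?_⟩
  · rw [← h, zero_smul] at hyx
    exact hy0 (neg_eq_zero.1 hyx.symm)
  · rw [hyx, neg_neg]
    exact hCB hy

/-- For a basis `D ⊆ B`, the complement `B \ D` is again a basis, so every member of `B` lies in a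
basis contained in `B`. -/
theorem exists_opposite (hB : IsExtremalPositiveBasis B) {x : E} (hx : x ∈ B) :
    ∃ c : ℝ, 0 < c ∧ -(c • x) ∈ B := by
  obtain ⟨D, hDB, hD, hDli, hDc⟩ :=
    exists_basis_finset_subset (span_eq_top_of_hull_eq_top hB.hull_eq_top)
  have hDB : D ⊆ B := by exact_mod_cast hDB
  by_cases hxD : x ∈ D
  · exact hB.exists_opposite_of_mem hDB hD hDc hDli hxD
  · exact hB.exists_opposite_of_mem Finset.sdiff_subset (hB.span_sdiff hDB hD hDc)
      (by rw [Finset.card_sdiff_of_subset hDB, hB.card_eq, hDc]; omega)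
      (hB.exists_sum_sdiff hDB hD hDc (w := 1) (by simp)).1 (Finset.mem_sdiff.2 ⟨hx, hxD⟩)

end IsExtremalPositiveBasis

end PositiveSpanning

/-! ### Crosspolytopes with independent semi-axes. -/

section SkewCrossPolytope

/-- The function with slope `a` on the positive and `-b` on the negative half-line. -/
def skewAbs (a b t : ℝ) : ℝ := max (a * t) (-(b * t))

theorem skewAbs_of_nonneg {a b t : ℝ} (ha : 0 < a) (hb : 0 < b) (ht : 0 ≤ t) :
    skewAbs a b t = a * t :=
  max_eq_left (by nlinarith)

theorem skewAbs_of_nonpos {a b t : ℝ} (ha : 0 < a) (hb : 0 < b) (ht : t ≤ 0) :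
    skewAbs a b t = -(b * t) :=
  max_eq_right (by nlinarith)

theorem skewAbs_nonneg {a b : ℝ} (ha : 0 < a) (hb : 0 < b) (t : ℝ) : 0 ≤ skewAbs a b t := by
  rcases le_total 0 t with h | h
  · rw [skewAbs_of_nonneg ha hb h]; positivity
  · rw [skewAbs_of_nonpos ha hb h]; nlinarith

variable {ι : Type*} [Fintype ι] {E : Type*} [AddCommGroup E] [Module ℝ E]

/-- For positive `α` and `β`, the convex hull of `0` and the points `b k / α k`, `- b k / β k`. -/
def skewCrossPolytope (b : Module.Basis ι ℝ E) (α β : ι → ℝ) : Set E :=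
  {x | ∑ k, skewAbs (α k) (β k) (b.repr x k) ≤ 1}

/-- The points in the boundary of a skew crosspolytope whose coordinates have signs as prescribed
by `σ`, or vanish. -/
def skewCrossPolytopeFace (b : Module.Basis ι ℝ E) (α β : ι → ℝ) (σ : ι → SignType) : Set E :=
  {x | ∑ k, skewAbs (α k) (β k) (b.repr x k) = 1 ∧
    ∀ k, (0 < b.repr x k → σ k = 1) ∧ (b.repr x k < 0 → σ k = -1)}

theorem convex_skewCrossPolytope (b : Module.Basis ι ℝ E) (α β : ι → ℝ) :
    Convex ℝ (skewCrossPolytope b α β) := by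
  have h : ConvexOn ℝ Set.univ fun x : E => ∑ k, skewAbs (α k) (β k) (b.repr x k) := by
    refine ⟨convex_univ, fun x _ y _ s t hs ht _ => ?_⟩
    simp only [smul_eq_mul, Finset.mul_sum, ← Finset.sum_add_distrib, map_add, map_smul,
      Finsupp.add_apply, Finsupp.smul_apply]
    refine Finset.sum_le_sum fun k _ => max_le ?_ ?_
    · have h1 := mul_le_mul_of_nonneg_left (le_max_left (α k * b.repr x k) (-(β k * b.repr x k))) hs
      have h2 := mul_le_mul_of_nonneg_left (le_max_left (α k * b.repr y k) (-(β k * b.repr y k))) ht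
      unfold skewAbs
      linarith
    · have h1 := mul_le_mul_of_nonneg_left (le_max_right (α k * b.repr x k) (-(β k * b.repr x k))) hs
      have h2 := mul_le_mul_of_nonneg_left (le_max_right (α k * b.repr y k) (-(β k * b.repr y k))) ht
      unfold skewAbs
      linarith
  simpa [skewCrossPolytope] using h.convex_le 1

theorem linear_apply_eq_sum (b : Module.Basis ι ℝ E) (l : E →ₗ[ℝ] ℝ) (x : E) :
    l x = ∑ k, l (b k) * b.repr x k := by
  conv_lhs => rw [← b.sum_repr x, map_sum]
  exact Finset.sum_congr rfl fun k _ => by rw [map_smul, smul_eq_mul, mul_comm]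

variable {α β : ι → ℝ}

theorem mul_le_skewAbs {a b l h : ℝ} (ha : 0 < a) (hb : 0 < b) (h1 : l ≤ h * a)
    (h2 : -l ≤ h * b) (t : ℝ) : l * t ≤ h * skewAbs a b t := by
  rcases le_total 0 t with ht | ht
  · rw [skewAbs_of_nonneg ha hb ht]; nlinarith
  · rw [skewAbs_of_nonpos ha hb ht]; nlinarith

theorem sum_mul_le_skewAbs (hα : ∀ k, 0 < α k) (hβ : ∀ k, 0 < β k) {l : ι → ℝ} {h : ℝ}
    (h1 : ∀ k, l k ≤ h * α k) (h2 : ∀ k, -l k ≤ h * β k) (t : ι → ℝ) :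
    ∑ k, l k * t k ≤ h * ∑ k, skewAbs (α k) (β k) (t k) := by
  rw [Finset.mul_sum]
  exact Finset.sum_le_sum fun k _ => mul_le_skewAbs (hα k) (hβ k) (h1 k) (h2 k) (t k)

/-- The equality case determines the faces: a nonzero coordinate is allowed only on a half-axis
whose vertex attains the maximum `h`. -/
theorem mul_eq_skewAbs_iff {a b l h : ℝ} (ha : 0 < a) (hb : 0 < b) (t : ℝ) :
    l * t = h * skewAbs a b t ↔ (0 < t → l = h * a) ∧ (t < 0 → -l = h * b) := by
  rcases lt_trichotomy t 0 with ht | rfl | ht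
  · rw [skewAbs_of_nonpos ha hb ht.le]
    constructor
    · refine fun h0 => ⟨fun h' => absurd h' ht.not_gt, fun _ => ?_⟩
      exact mul_right_cancel₀ ht.ne (by linarith)
    · intro h0; linear_combination -t * h0.2 ht
  · simp [skewAbs]
  · rw [skewAbs_of_nonneg ha hb ht.le]
    constructor
    · refine fun h0 => ⟨fun _ => ?_, fun h' => absurd h' ht.not_gt⟩
      exact mul_right_cancel₀ ht.ne' (by linarith)
    · intro h0; linear_combination t * h0.1 ht

theorem sum_mul_eq_skewAbs_iff (hα : ∀ k, 0 < α k) (hβ : ∀ k, 0 < β k) {l : ι → ℝ} {h : ℝ}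
    (h1 : ∀ k, l k ≤ h * α k) (h2 : ∀ k, -l k ≤ h * β k) (t : ι → ℝ) :
    ∑ k, l k * t k = h * ∑ k, skewAbs (α k) (β k) (t k) ↔
      ∀ k, (0 < t k → l k = h * α k) ∧ (t k < 0 → -l k = h * β k) := by
  rw [Finset.mul_sum, Finset.sum_eq_sum_iff_of_le fun k _ =>
    mul_le_skewAbs (hα k) (hβ k) (h1 k) (h2 k) (t k)]
  simp only [Finset.mem_univ, true_imp_iff, mul_eq_skewAbs_iff (hα _) (hβ _)]

theorem zero_mem_skewCrossPolytope (b : Module.Basis ι ℝ E) :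
    (0 : E) ∈ skewCrossPolytope b α β := by
  simp [skewCrossPolytope, skewAbs]

theorem smul_basis_mem_skewCrossPolytope (hα : ∀ k, 0 < α k) (hβ : ∀ k, 0 < β k)
    (b : Module.Basis ι ℝ E) {k : ι} {t : ℝ} (ht : 0 ≤ t) (htk : α k * t ≤ 1) :
    t • b k ∈ skewCrossPolytope b α β := by
  classical
  simp only [skewCrossPolytope, Set.mem_ofPred_eq]
  rw [Finset.sum_eq_single_of_mem k (Finset.mem_univ k) fun j _ hj => by
    simp [hj.symm, skewAbs]]
  simpa [skewAbs_of_nonneg (hα k) (hβ k) ht] using htk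

theorem neg_smul_basis_mem_skewCrossPolytope (hα : ∀ k, 0 < α k) (hβ : ∀ k, 0 < β k)
    (b : Module.Basis ι ℝ E) {k : ι} {t : ℝ} (ht : 0 ≤ t) (htk : β k * t ≤ 1) :
    -(t • b k) ∈ skewCrossPolytope b α β := by
  classical
  simp only [skewCrossPolytope, Set.mem_ofPred_eq]
  rw [Finset.sum_eq_single_of_mem k (Finset.mem_univ k) fun j _ hj => by
    simp [hj.symm, skewAbs]]
  simpa [skewAbs_of_nonpos (hα k) (hβ k) (neg_nonpos.2 ht)] using htk

/-- A convex set that contains `0` and the points `b k / α k`, `- b k / β k` contains the skew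
crosspolytope. -/
theorem skewCrossPolytope_subset (hα : ∀ k, 0 < α k) (hβ : ∀ k, 0 < β k)
    (b : Module.Basis ι ℝ E) {K : Set E} (hK : Convex ℝ K) (h0 : 0 ∈ K)
    (h1 : ∀ k, (α k)⁻¹ • b k ∈ K) (h2 : ∀ k, -((β k)⁻¹ • b k) ∈ K) :
    skewCrossPolytope b α β ⊆ K := by
  intro x hx
  simp only [skewCrossPolytope, Set.mem_ofPred_eq] at hx
  let s : ι → ℝ := fun k => skewAbs (α k) (β k) (b.repr x k)
  let u : ι → E := fun k => if 0 ≤ b.repr x k then (α k)⁻¹ • b k else -((β k)⁻¹ • b k)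
  have hsu : ∀ k, s k • u k = b.repr x k • b k := by
    intro k
    simp only [s, u]
    split_ifs with h
    · rw [skewAbs_of_nonneg (hα k) (hβ k) h, smul_smul]
      congr 1
      field_simp [(hα k).ne']
    · rw [skewAbs_of_nonpos (hα k) (hβ k) (not_le.1 h).le, smul_neg, smul_smul, ← neg_smul]
      congr 1
      field_simp [(hβ k).ne']
  -- The extra index `none` places the slack `1 - ∑ k, s k` at the point 0.
  have := hK.sum_mem (t := Finset.univ) (w := fun o : Option ι => o.elim (1 - ∑ k, s k) s)
    (z := fun o : Option ι => o.elim 0 u) ?_ ?_ ?_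
  · rw [Fintype.sum_option] at this
    simp only [Option.elim, smul_zero, zero_add] at this
    rwa [Finset.sum_congr rfl fun k _ => hsu k, b.sum_repr] at this
  · rintro (_ | k) -
    · simpa [s] using hx
    · exact skewAbs_nonneg (hα k) (hβ k) _
  · simp [Fintype.sum_option]
  · rintro (_ | k) -
    · exact h0
    · simp only [Option.elim, u]
      split_ifs
      · exact h1 k
      · exact h2 k

end SkewCrossPolytope

/-! ### Exposed faces as sign vectors. -/

section Faces

variable {ι : Type*} [Fintype ι] {E : Type*} [NormedAddCommGroup E] [NormedSpace ℝ E]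
  {α β : ι → ℝ}

theorem exists_sign_of_isExposed (hα : ∀ k, 0 < α k) (hβ : ∀ k, 0 < β k)
    (b : Module.Basis ι ℝ E) {F : Set E} (hF : IsExposed ℝ (skewCrossPolytope b α β) F)
    (hne : F.Nonempty) :
    F = skewCrossPolytope b α β ∨ ∃ σ, F = skewCrossPolytopeFace b α β σ := by
  classical
  obtain ⟨l, hl⟩ := hF hne
  obtain ⟨x₀, hx₀⟩ := hne
  have hx₀ := hx₀
  rw [hl] at hx₀
  obtain ⟨hx₀Q, hmax⟩ := hx₀
  set h := l x₀
  have hlx : ∀ x, l x = ∑ k, l (b k) * b.repr x k := linear_apply_eq_sum b l.toLinearMap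
  have h1 : ∀ k, l (b k) ≤ h * α k := by
    intro k
    have := hmax _ (smul_basis_mem_skewCrossPolytope hα hβ b (k := k) (t := (α k)⁻¹)
      (inv_nonneg.2 (hα k).le) (mul_inv_cancel₀ (hα k).ne').le)
    rw [map_smul, smul_eq_mul, inv_mul_le_iff₀ (hα k)] at this
    linarith
  have h2 : ∀ k, -l (b k) ≤ h * β k := by
    intro k
    have := hmax _ (neg_smul_basis_mem_skewCrossPolytope hα hβ b (k := k) (t := (β k)⁻¹)
      (inv_nonneg.2 (hβ k).le) (mul_inv_cancel₀ (hβ k).ne').le)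
    rw [map_neg, map_smul, smul_eq_mul, ← mul_neg, inv_mul_le_iff₀ (hβ k)] at this
    linarith
  have hh : 0 ≤ h := by simpa using hmax 0 (zero_mem_skewCrossPolytope b)
  rcases hh.eq_or_lt with hh | hh
  · left
    have hlk : ∀ k, l (b k) = 0 := fun k => by
      have := h1 k; have := h2 k
      rw [← hh, zero_mul] at *
      linarith
    have hl0 : ∀ x, l x = 0 := fun x => by rw [hlx]; simp [hlk]
    rw [hl]; ext x; simp [hl0]
  · right
    -- The sign `σ k` records which of the two vertices on the `k`-th axis attains the maximum; both
    -- cannot, because `h > 0`.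
    refine ⟨fun k => if l (b k) = h * α k then 1 else if -l (b k) = h * β k then -1 else 0, ?_⟩
    have hle : ∀ x, l x ≤ h * ∑ k, skewAbs (α k) (β k) (b.repr x k) := fun x => by
      rw [hlx]; exact sum_mul_le_skewAbs hα hβ h1 h2 _
    have heq : ∀ x, l x = h * ∑ k, skewAbs (α k) (β k) (b.repr x k) ↔
        ∀ k, (0 < b.repr x k → l (b k) = h * α k) ∧
          (b.repr x k < 0 → -l (b k) = h * β k) := fun x => by
      rw [hlx]; exact sum_mul_eq_skewAbs_iff hα hβ h1 h2 _
    have hsgn : ∀ x : E, (∀ k, (0 < b.repr x k → l (b k) = h * α k) ∧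
        (b.repr x k < 0 → -l (b k) = h * β k)) ↔ ∀ k, (0 < b.repr x k →
        (if l (b k) = h * α k then 1 else if -l (b k) = h * β k then -1 else 0 : SignType) = 1) ∧
        (b.repr x k < 0 →
        (if l (b k) = h * α k then 1 else if -l (b k) = h * β k then -1 else 0 : SignType) = -1) := by
      intro x
      refine forall_congr' fun k => and_congr (imp_congr_right fun _ => ?_)
        (imp_congr_right fun _ => ?_)
      · constructor
        · intro e; rw [if_pos e]
        · intro e; by_contra hc
          rw [if_neg hc] at e
          split_ifs at e
      · by_cases hk : l (b k) = h * α k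
        · have := mul_pos hh (hα k)
          have := mul_pos hh (hβ k)
          rw [if_pos hk]
          exact ⟨fun e => by linarith, fun e => absurd e (by decide)⟩
        · rw [if_neg hk]
          constructor
          · intro e; rw [if_pos e]
          · intro e; by_contra hc
            rw [if_neg hc] at e
            exact absurd e (by decide)
    rw [hl]
    ext x
    simp only [Set.mem_ofPred_eq, skewCrossPolytopeFace]
    rw [← hsgn, ← heq]
    constructor
    · rintro ⟨hx, hxm⟩
      have hhx : h ≤ l x := hxm x₀ hx₀Q
      have h3 := hle x
      have hx' : ∑ k, skewAbs (α k) (β k) (b.repr x k) ≤ 1 := hx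
      have h4 : ∑ k, skewAbs (α k) (β k) (b.repr x k) = 1 := by
        refine le_antisymm hx' ?_
        exact le_of_mul_le_mul_left (by linarith) hh
      refine ⟨h4, le_antisymm h3 ?_⟩
      rw [h4, mul_one]; exact hhx
    · rintro ⟨hx, hxl⟩
      refine ⟨hx.le, fun y hy => ?_⟩
      rw [hxl, hx, mul_one]
      exact hmax y hy

variable [FiniteDimensional ℝ E]

theorem isExposed_skewCrossPolytopeFace (hα : ∀ k, 0 < α k) (hβ : ∀ k, 0 < β k)
    (b : Module.Basis ι ℝ E) (σ : ι → SignType) :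
    IsExposed ℝ (skewCrossPolytope b α β) (skewCrossPolytopeFace b α β σ) := by
  classical
  rintro ⟨x₀, hx₀⟩
  let l : E →ₗ[ℝ] ℝ :=
    b.constr ℝ fun k => if σ k = 1 then α k else if σ k = -1 then -β k else 0
  have hlb : ∀ k, l (b k) = if σ k = 1 then α k else if σ k = -1 then -β k else 0 :=
    fun k => b.constr_basis ℝ _ k
  have h1 : ∀ k, l (b k) ≤ 1 * α k := fun k => by
    have := hα k; have := hβ k
    rw [hlb]; split_ifs <;> linarith
  have h2 : ∀ k, -l (b k) ≤ 1 * β k := fun k => by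
    have := hα k; have := hβ k
    rw [hlb]; split_ifs <;> linarith
  have hle : ∀ x, l x ≤ ∑ k, skewAbs (α k) (β k) (b.repr x k) := fun x => by
    rw [linear_apply_eq_sum b l]; simpa using sum_mul_le_skewAbs hα hβ h1 h2 _
  have heq : ∀ x, l x = ∑ k, skewAbs (α k) (β k) (b.repr x k) ↔
      ∀ k, (0 < b.repr x k → σ k = 1) ∧ (b.repr x k < 0 → σ k = -1) := fun x => by
    have := sum_mul_eq_skewAbs_iff hα hβ h1 h2 (b.repr x)
    rw [linear_apply_eq_sum b l]
    rw [one_mul] at this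
    rw [this]
    refine forall_congr' fun k => and_congr (imp_congr_right fun _ => ?_)
        (imp_congr_right fun _ => ?_)
    · have := hα k; have := hβ k
      rw [hlb, one_mul]
      constructor
      · intro h; by_contra hc; rw [if_neg hc] at h; split_ifs at h <;> linarith
      · intro h; rw [if_pos h]
    · have := hα k; have := hβ k
      rw [hlb, one_mul]
      constructor
      · intro h; by_contra hc; rw [if_neg hc] at h; split_ifs at h <;> linarith
      · intro h; rw [h]; simp
  refine ⟨LinearMap.toContinuousLinearMap l, ?_⟩
  ext x
  simp only [skewCrossPolytopeFace, Set.mem_ofPred_eq, LinearMap.coe_toContinuousLinearMap']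
  rw [← heq]
  have hx₀l : l x₀ = 1 := ((heq x₀).2 hx₀.2).trans hx₀.1
  constructor
  · rintro ⟨hx, hxl⟩
    refine ⟨hx.le, fun y hy => ?_⟩
    rw [hxl, hx]
    exact (hle y).trans hy
  · rintro ⟨hx, hxl⟩
    have h3 := hxl x₀ hx₀.1.le
    have h4 := hle x
    have h5 : ∑ k, skewAbs (α k) (β k) (b.repr x k) ≤ 1 := hx
    constructor <;> linarith

theorem isExposed_skewCrossPolytope_iff (hα : ∀ k, 0 < α k) (hβ : ∀ k, 0 < β k)
    (b : Module.Basis ι ℝ E) {F : Set E} :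
    IsExposed ℝ (skewCrossPolytope b α β) F ↔
      F = skewCrossPolytope b α β ∨ ∃ σ, F = skewCrossPolytopeFace b α β σ := by
  constructor
  · intro hF
    rcases F.eq_empty_or_nonempty with rfl | hne
    -- The zero sign vector forces all coordinates to vanish, which contradicts lying on the
    -- boundary, so it encodes the empty face.
    · refine Or.inr ⟨0, Eq.symm (Set.eq_empty_of_forall_notMem ?_)⟩
      rintro x ⟨hx, hσ⟩
      have : ∀ k, b.repr x k = 0 := fun k => by
        have h := hσ k
        simp only [Pi.zero_apply] at h
        rcases lt_trichotomy (b.repr x k) 0 with h' | h' | h'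
        · exact absurd (h.2 h') (by decide)
        · exact h'
        · exact absurd (h.1 h') (by decide)
      simp [this, skewAbs] at hx
    · exact exists_sign_of_isExposed hα hβ b hF hne
  · rintro (rfl | ⟨σ, rfl⟩)
    · exact IsExposed.refl _
    · exact isExposed_skewCrossPolytopeFace hα hβ b σ

end Faces

/-! ### Combinatorial equivalence with the standard crosspolytope. -/

section Comparison

/-- The piecewise linear bijection of the line with slopes `a` and `b`. -/
noncomputable def skewScale {a b : ℝ} (ha : 0 < a) (hb : 0 < b) : ℝ ≃ ℝ where
  toFun t := if 0 ≤ t then a * t else b * t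
  invFun t := if 0 ≤ t then a⁻¹ * t else b⁻¹ * t
  left_inv t := by
    dsimp only
    rcases le_or_gt 0 t with h | h
    · rw [if_pos h, if_pos (by positivity), inv_mul_cancel_left₀ ha.ne']
    · rw [if_neg h.not_ge, if_neg (mul_neg_of_pos_of_neg hb h).not_ge, inv_mul_cancel_left₀ hb.ne']
  right_inv t := by
    dsimp only
    rcases le_or_gt 0 t with h | h
    · rw [if_pos h, if_pos (by positivity), mul_inv_cancel_left₀ ha.ne']
    · rw [if_neg h.not_ge, if_neg (mul_neg_of_pos_of_neg (inv_pos.2 hb) h).not_ge,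
        mul_inv_cancel_left₀ hb.ne']

theorem skewScale_pos_iff {a b : ℝ} (ha : 0 < a) (hb : 0 < b) {t : ℝ} :
    0 < skewScale ha hb t ↔ 0 < t := by
  simp only [skewScale, Equiv.coe_fn_mk]
  split_ifs with h
  · simp [ha]
  · simp [hb]

theorem skewScale_neg_iff {a b : ℝ} (ha : 0 < a) (hb : 0 < b) {t : ℝ} :
    skewScale ha hb t < 0 ↔ t < 0 := by
  simp only [skewScale, Equiv.coe_fn_mk]
  split_ifs with h
  · simp only [mul_neg_iff, ha, ha.not_gt, true_and, false_and, or_false]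
  · simp only [mul_neg_iff, hb, hb.not_gt, true_and, false_and, or_false]

theorem skewAbs_one_skewScale {a b : ℝ} (ha : 0 < a) (hb : 0 < b) (t : ℝ) :
    skewAbs 1 1 (skewScale ha hb t) = skewAbs a b t := by
  rcases le_or_gt 0 t with h | h
  · rw [skewAbs_of_nonneg ha hb h]
    simp only [skewScale, Equiv.coe_fn_mk, if_pos h]
    rw [skewAbs_of_nonneg one_pos one_pos (by positivity), one_mul]
  · rw [skewAbs_of_nonpos ha hb h.le]
    simp only [skewScale, Equiv.coe_fn_mk, if_neg h.not_ge]
    rw [skewAbs_of_nonpos one_pos one_pos (mul_neg_of_pos_of_neg hb h).le, one_mul]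

variable {ι : Type*} [Fintype ι]
  {E F : Type*} [NormedAddCommGroup E] [NormedSpace ℝ E] [FiniteDimensional ℝ E]
  [NormedAddCommGroup F] [NormedSpace ℝ F] [FiniteDimensional ℝ F] {α β : ι → ℝ}

/-- The coordinatewise rescaling `φ` is only piecewise linear, but it preserves signs and the gauge,
and these alone determine the exposed faces. -/
theorem combEquiv_skewCrossPolytope (hα : ∀ k, 0 < α k) (hβ : ∀ k, 0 < β k)
    (b : Module.Basis ι ℝ E) (b' : Module.Basis ι ℝ F) :
    CombEquiv (skewCrossPolytope b α β) (skewCrossPolytope b' 1 1) := by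
  let φ : E ≃ F := b.equivFun.toEquiv.trans
    ((Equiv.piCongrRight fun k => skewScale (hα k) (hβ k)).trans b'.equivFun.symm.toEquiv)
  have hφ : ∀ x k, b'.repr (φ x) k = skewScale (hα k) (hβ k) (b.repr x k) := by
    intro x k
    rw [← b'.equivFun_apply]
    simp only [φ, Equiv.trans_apply, LinearEquiv.coe_toEquiv, LinearEquiv.apply_symm_apply,
      Equiv.piCongrRight_apply, Pi.map_apply, b.equivFun_apply]
  have hsum : ∀ x, ∑ k, skewAbs ((1 : ι → ℝ) k) ((1 : ι → ℝ) k) (b'.repr (φ x) k) =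
      ∑ k, skewAbs (α k) (β k) (b.repr x k) := fun x =>
    Finset.sum_congr rfl fun k _ => by
      rw [hφ]; exact skewAbs_one_skewScale (hα k) (hβ k) _
  have hQ : φ ⁻¹' skewCrossPolytope b' 1 1 = skewCrossPolytope b α β := by
    ext x; simp only [skewCrossPolytope, Set.mem_preimage, Set.mem_ofPred_eq, hsum]
  have hface : ∀ σ, φ ⁻¹' skewCrossPolytopeFace b' 1 1 σ = skewCrossPolytopeFace b α β σ := by
    intro σ; ext x
    simp only [skewCrossPolytopeFace, Set.mem_preimage, Set.mem_ofPred_eq, hsum]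
    simp only [hφ, skewScale_pos_iff, skewScale_neg_iff]
  have h1 : ∀ k, (0 : ℝ) < (1 : ι → ℝ) k := fun _ => one_pos
  have hiff : ∀ G : Set F, IsExposed ℝ (skewCrossPolytope b α β) (φ ⁻¹' G) ↔
      IsExposed ℝ (skewCrossPolytope b' 1 1) G := by
    intro G
    rw [isExposed_skewCrossPolytope_iff hα hβ, isExposed_skewCrossPolytope_iff h1 h1, ← hQ]
    simp only [← hface, φ.surjective.preimage_injective.eq_iff]
  refine ⟨OrderIso.symm
    { toFun := fun G => ⟨φ ⁻¹' G.1, (hiff G.1).2 G.2⟩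
      invFun := fun G => ⟨φ.symm ⁻¹' G.1, (hiff _).1 ?_⟩
      left_inv := fun G => Subtype.ext (by simp [← Set.preimage_comp])
      right_inv := fun G => Subtype.ext (by simp [← Set.preimage_comp])
      map_rel_iff' := ?_ }⟩
  · simpa [← Set.preimage_comp] using G.2
  · intro G H
    exact φ.surjective.preimage_subset_preimage_iff

theorem crossPolytope_eq (d : ℕ) :
    crossPolytope d = skewCrossPolytope (Pi.basisFun ℝ (Fin d)) 1 1 := by
  ext x
  simp [crossPolytope, skewCrossPolytope, skewAbs, abs]

end Comparison

/-! ### Irredundant families that positively span. -/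

section Transversal

variable {E : Type*} [NormedAddCommGroup E] [NormedSpace ℝ E]
  {ι : Type*} {X : ι → Set E} {v : ι → Module.Dual ℝ E}

/-- The sets `X i` positively span the space, but each of them is needed for this, as witnessed by
the linear form `v i`. -/
structure IsIrredundant (X : ι → Set E) (v : ι → Module.Dual ℝ E) : Prop where
  hull_eq_top : PointedCone.hull ℝ (⋃ i, X i) = ⊤
  nonneg : ∀ i j, j ≠ i → ∀ x ∈ X j, 0 ≤ v i x
  ne_zero : ∀ i, v i ≠ 0

theorem eq_zero_of_nonneg_on {T : Set E} (hT : PointedCone.hull ℝ T = ⊤) {f : Module.Dual ℝ E}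
    (hf : ∀ x ∈ T, 0 ≤ f x) : f = 0 := by
  have h : ∀ x, 0 ≤ f x := by
    intro x
    have hle : PointedCone.hull ℝ T ≤ (PointedCone.positive ℝ ℝ).comap f :=
      Submodule.span_le.2 fun y hy => hf y hy
    have hx : x ∈ PointedCone.hull ℝ T := hT ▸ Submodule.mem_top
    exact hle hx
  ext x
  have := h (-x)
  rw [map_neg] at this
  simpa using le_antisymm (by linarith) (h x)

theorem exists_basis_of_span_eq_top [FiniteDimensional ℝ E] {T : Set E} (hT : Submodule.span ℝ T = ⊤) :
    ∃ b : Module.Basis (Fin (Module.finrank ℝ E)) ℝ E, ∀ k, b k ∈ T := by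
  obtain ⟨D, hDT, hD, hli, hc⟩ := exists_basis_finset_subset hT
  have hli' : LinearIndependent ℝ (fun x : D => (x : E)) := hli
  let b := Module.Basis.mk hli' (by rw [Subtype.range_coe_subtype]; exact hD.ge)
  refine ⟨b.reindex (Fintype.equivFinOfCardEq (by simpa using hc)), fun k => hDT ?_⟩
  simp [b]

namespace IsIrredundant

/-- Otherwise `v i` would be nonnegative on all of the positively spanning set `T`, hence zero. -/
theorem exists_neg (h : IsIrredundant X v) {T : Set E} (hTX : T ⊆ ⋃ i, X i)
    (hT : PointedCone.hull ℝ T = ⊤) (i : ι) : ∃ x ∈ T, x ∈ X i ∧ v i x < 0 := by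
  by_contra! hneg
  refine h.ne_zero i (eq_zero_of_nonneg_on hT fun x hx => ?_)
  obtain ⟨j, hj⟩ := Set.mem_iUnion.1 (hTX hx)
  by_cases hji : j = i
  · exact hneg x hx (hji ▸ hj)
  · exact h.nonneg i j hji x hj

theorem exists_transversal (h : IsIrredundant X v) {T : Set E} (hTX : T ⊆ ⋃ i, X i)
    (hT : PointedCone.hull ℝ T = ⊤) :
    ∃ x : ι → E, Function.Injective x ∧ ∀ i, x i ∈ T ∧ x i ∈ X i ∧ v i (x i) < 0 := by
  choose x hxT hxX hxv using h.exists_neg hTX hT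
  refine ⟨x, fun i j hij => ?_, fun i => ⟨hxT i, hxX i, hxv i⟩⟩
  by_contra hne
  have := h.nonneg i j (Ne.symm hne) (x j) (hxX j)
  rw [← hij] at this
  exact absurd (hxv i) this.not_gt

variable [Fintype ι]

theorem card_le_of_hull_eq_top (h : IsIrredundant X v) {T : Finset E} (hTX : (T : Set E) ⊆ ⋃ i, X i)
    (hT : PointedCone.hull ℝ (T : Set E) = ⊤) : Fintype.card ι ≤ T.card := by
  obtain ⟨x, hx, hxT⟩ := h.exists_transversal hTX hT
  rw [← Finset.card_univ]
  exact Finset.card_le_card_of_injOn x (fun i _ => (hxT i).1) hx.injOn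

variable [FiniteDimensional ℝ E]

theorem card_le (h : IsIrredundant X v) : Fintype.card ι ≤ 2 * Module.finrank ℝ E := by
  obtain ⟨B, hBX, hB, hBc⟩ := exists_small_positively_spanning h.hull_eq_top
  exact (h.card_le_of_hull_eq_top hBX hB).trans hBc

/-- If the number of sets is twice the dimension, then there is a transversal that consists of a
basis and of negative multiples of its members. -/
theorem exists_basis_transversal (h : IsIrredundant X v)
    (hc : Fintype.card ι = 2 * Module.finrank ℝ E) :
    ∃ (x : ι → E) (b : Module.Basis (Fin (Module.finrank ℝ E)) ℝ E)
      (a o : Fin (Module.finrank ℝ E) → ι) (c : Fin (Module.finrank ℝ E) → ℝ),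
      (∀ i, x i ∈ X i ∧ v i (x i) < 0) ∧
        ∀ k, 0 < c k ∧ x (a k) = b k ∧ x (o k) = -(c k • b k) := by
  classical
  obtain ⟨B, hBX, hB, hBc⟩ := exists_small_positively_spanning h.hull_eq_top
  obtain ⟨x, hx, hxB⟩ := h.exists_transversal hBX hB
  have hcard : B.card = 2 * Module.finrank ℝ E :=
    le_antisymm hBc (hc ▸ h.card_le_of_hull_eq_top hBX hB)
  -- Minimality comes from the transversal: every positively spanning subset of `B` has at least
  -- `|ι| = 2d = |B|` elements.
  have hext : IsExtremalPositiveBasis B :=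
    ⟨hB, fun T hTB hT => Finset.eq_of_subset_of_card_le hTB
      (by rw [hcard, ← hc]
          exact h.card_le_of_hull_eq_top ((Finset.coe_subset.2 hTB).trans hBX) hT), hcard⟩
  have himage : Finset.univ.image x = B := Finset.eq_of_subset_of_card_le
    (Finset.image_subset_iff.2 fun i _ => (hxB i).1)
    (by rw [Finset.card_image_of_injective _ hx, Finset.card_univ, hc, hcard])
  have hsurj : ∀ y ∈ B, ∃ i, x i = y := by
    intro y hy
    rw [← himage, Finset.mem_image] at hy
    simpa using hy
  obtain ⟨b, hbB⟩ := exists_basis_of_span_eq_top (span_eq_top_of_hull_eq_top hB)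
  choose a ha using fun k => hsurj _ (hbB k)
  choose c hcpos hcB using fun k => hext.exists_opposite (hbB k)
  choose o ho using fun k => hsurj _ (hcB k)
  exact ⟨x, b, a, o, c, fun i => (hxB i).2, fun k => ⟨hcpos k, ha k, ho k⟩⟩

/-- The forms `v (a k)` and `v (o k)` are a negative and a positive multiple of the `k`-th
coordinate. So only `X (a k)` can have positive and only `X (o k)` negative `k`-th coordinates, and
each set lies on one half-axis. -/
theorem exists_convexHull_eq_skewCrossPolytope (h : IsIrredundant X v)
    (hc : Fintype.card ι = 2 * Module.finrank ℝ E) [Nonempty ι] (h0 : ∀ i, 0 ∈ X i)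
    (hcomp : ∀ i, IsCompact (X i)) :
    ∃ (b : Module.Basis (Fin (Module.finrank ℝ E)) ℝ E) (α β : Fin (Module.finrank ℝ E) → ℝ),
      (∀ k, 0 < α k) ∧ (∀ k, 0 < β k) ∧
        convexHull ℝ (⋃ i, X i) = skewCrossPolytope b α β := by
  classical
  obtain ⟨x, b, a, o, c, hx, hbac⟩ := h.exists_basis_transversal hc
  have hcpos : ∀ k, 0 < c k := fun k => (hbac k).1
  have hxa : ∀ k, x (a k) = b k := fun k => (hbac k).2.1
  have hxo : ∀ k, x (o k) = -(c k • b k) := fun k => (hbac k).2.2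
  have hbX : ∀ k, b k ∈ X (a k) := fun k => hxa k ▸ (hx _).1
  have hbv : ∀ k, v (a k) (b k) < 0 := fun k => hxa k ▸ (hx _).2
  have hoX : ∀ k, -(c k • b k) ∈ X (o k) := fun k => hxo k ▸ (hx _).1
  have hov : ∀ k, 0 < v (o k) (b k) := fun k => by
    have := (hx (o k)).2
    rw [hxo, map_neg, map_smul, smul_eq_mul, neg_lt_zero] at this
    exact (mul_pos_iff_of_pos_left (hcpos k)).1 this
  have hao : ∀ j k, a j ≠ o k := by
    intro j k hjk
    have h1 := congrArg (fun z => b.repr z k) ((hxa j).symm.trans ((congrArg x hjk).trans (hxo k)))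
    by_cases hne : j = k
    · subst hne
      simp at h1
      linarith [hcpos j]
    · simp [hne] at h1
      linarith [hcpos k]
  have haa : ∀ j k, j ≠ k → a j ≠ a k := fun j k hne hjk =>
    hne (b.injective (by rw [← hxa, ← hxa, hjk]))
  have hoo : ∀ j k, j ≠ k → o j ≠ o k := by
    intro j k hne hjk
    have h1 := congrArg (fun z => b.repr z k) ((hxo j).symm.trans ((congrArg x hjk).trans (hxo k)))
    simp [hne] at h1
    linarith [hcpos k]
  -- Here `v i` is nonnegative both on `b k` and on a negative multiple of it.
  have hvan : ∀ i k, i ≠ a k → i ≠ o k → v i (b k) = 0 := by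
    intro i k h1 h2
    refine le_antisymm ?_ (h.nonneg i _ h1.symm _ (hbX k))
    have := h.nonneg i _ h2.symm _ (hoX k)
    rw [map_neg, map_smul, smul_eq_mul, neg_nonneg] at this
    by_contra! hpos
    exact absurd (mul_pos (hcpos k) hpos) this.not_gt
  have hva : ∀ k y, v (a k) y = v (a k) (b k) * b.repr y k := fun k y => by
    rw [linear_apply_eq_sum b (v (a k)),
      Finset.sum_eq_single_of_mem k (Finset.mem_univ k) fun j _ hj => by
        rw [hvan _ j (haa k j hj.symm) (hao k j), zero_mul]]
  have hvo : ∀ k y, v (o k) y = v (o k) (b k) * b.repr y k := fun k y => by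
    rw [linear_apply_eq_sum b (v (o k)),
      Finset.sum_eq_single_of_mem k (Finset.mem_univ k) fun j _ hj => by
        rw [hvan _ j (hao j k).symm (hoo k j hj.symm), zero_mul]]
  have hnonpos : ∀ i k, i ≠ a k → ∀ y ∈ X i, b.repr y k ≤ 0 := by
    intro i k hik y hy
    have := h.nonneg (a k) i hik y hy
    rw [hva] at this
    by_contra! hpos
    exact absurd (mul_neg_of_neg_of_pos (hbv k) hpos) this.not_gt
  have hnonneg : ∀ i k, i ≠ o k → ∀ y ∈ X i, 0 ≤ b.repr y k := by
    intro i k hik y hy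
    have := h.nonneg (o k) i hik y hy
    rw [hvo] at this
    exact (mul_nonneg_iff_of_pos_left (hov k)).1 this
  have hcover : ∀ i, (∃ k, i = a k) ∨ ∃ k, i = o k := by
    intro i
    by_contra! hi
    exact h.ne_zero i (b.ext fun k => by simpa using hvan i k (hi.1 k) (hi.2 k))
  have hray : ∀ y k, (∀ j, j ≠ k → b.repr y j = 0) → y = b.repr y k • b k := by
    intro y k hy
    conv_lhs => rw [← b.sum_repr y]
    exact Finset.sum_eq_single_of_mem k (Finset.mem_univ k) fun j _ hj => by rw [hy j hj, zero_smul]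
  have haray : ∀ k, ∀ y ∈ X (a k), y = b.repr y k • b k := fun k y hy =>
    hray y k fun j hj => le_antisymm (hnonpos _ j (haa k j hj.symm) y hy)
      (hnonneg _ j (hao k j) y hy)
  have horay : ∀ k, ∀ y ∈ X (o k), y = b.repr y k • b k := fun k y hy =>
    hray y k fun j hj => le_antisymm (hnonpos _ j (hao j k).symm y hy)
      (hnonneg _ j (hoo k j hj.symm) y hy)
  have hcont : ∀ k, Continuous fun y => b.repr y k := fun k =>
    (b.coord k).continuous_of_finiteDimensional
  -- By compactness each set has a point farthest out on its half-axis; these points are the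
  -- vertices.
  have hA : ∀ k, ∃ w ∈ X (a k), ∀ y ∈ X (a k), b.repr y k ≤ b.repr w k := fun k =>
    (hcomp (a k)).exists_isMaxOn ⟨0, h0 _⟩ (hcont k).continuousOn
  have hO : ∀ k, ∃ w ∈ X (o k), ∀ y ∈ X (o k), b.repr w k ≤ b.repr y k := fun k =>
    (hcomp (o k)).exists_isMinOn ⟨0, h0 _⟩ (hcont k).continuousOn
  choose w hwX hwmax using hA
  choose u huX humin using hO
  have hwpos : ∀ k, 0 < b.repr (w k) k := fun k =>
    one_pos.trans_le (by simpa using hwmax k (b k) (hbX k))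
  have huneg : ∀ k, b.repr (u k) k < 0 := fun k =>
    (by simpa using humin k _ (hoX k) : b.repr (u k) k ≤ -c k).trans_lt (neg_lt_zero.2 (hcpos k))
  have hα : ∀ k, 0 < (b.repr (w k) k)⁻¹ := fun k => inv_pos.2 (hwpos k)
  have hβ : ∀ k, 0 < (-b.repr (u k) k)⁻¹ := fun k => inv_pos.2 (neg_pos.2 (huneg k))
  refine ⟨b, fun k => (b.repr (w k) k)⁻¹, fun k => (-b.repr (u k) k)⁻¹, hα, hβ,
    (convexHull_min ?_ (convex_skewCrossPolytope b _ _)).antisymm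
      (skewCrossPolytope_subset hα hβ b (convex_convexHull ℝ _) ?_ ?_ ?_)⟩
  · refine Set.iUnion_subset fun i y hy => ?_
    rcases hcover i with ⟨k, rfl⟩ | ⟨k, rfl⟩
    · rw [haray k y hy]
      refine smul_basis_mem_skewCrossPolytope hα hβ b (hnonneg _ k (hao k k) y hy) ?_
      rw [inv_mul_le_iff₀ (hwpos k), mul_one]
      exact hwmax k y hy
    · have : y = -((-b.repr y k) • b k) := by rw [neg_smul, neg_neg]; exact horay k y hy
      rw [this]
      refine neg_smul_basis_mem_skewCrossPolytope hα hβ b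
        (neg_nonneg.2 (hnonpos _ k (hao k k).symm y hy)) ?_
      rw [inv_mul_le_iff₀ (neg_pos.2 (huneg k)), mul_one]
      exact neg_le_neg (humin k y hy)
  · obtain ⟨i⟩ := ‹Nonempty ι›
    exact subset_convexHull ℝ _ (Set.mem_iUnion.2 ⟨i, h0 i⟩)
  · intro k
    rw [inv_inv, ← haray k _ (hwX k)]
    exact subset_convexHull ℝ _ (Set.mem_iUnion.2 ⟨_, hwX k⟩)
  · intro k
    rw [inv_inv, neg_smul, neg_neg, ← horay k _ (huX k)]
    exact subset_convexHull ℝ _ (Set.mem_iUnion.2 ⟨_, huX k⟩)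

end IsIrredundant

end Transversal

/-! ### From nef-partitions to irredundant families. -/

section NefPartition

theorem mem_translated_sum_iff {E : Type*} [AddCommGroup E] {r : ℕ} {Δ : Fin r → Set E}
    {p : Fin r → E} {z : E} : z ∈ (fun x => x - ∑ i, p i) '' (∑ i, Δ i) ↔
    ∃ y : Fin r → E, (∀ i, y i ∈ (fun x => x - p i) '' Δ i) ∧ ∑ i, y i = z := by
  constructor
  · rintro ⟨x, hx, rfl⟩
    obtain ⟨g, hg, rfl⟩ := (Set.mem_fintype_sum _ _).1 hx
    exact ⟨fun i => g i - p i, fun i => ⟨g i, hg i, rfl⟩, by simp⟩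
  · rintro ⟨y, hy, rfl⟩
    choose g hg hgy using hy
    refine ⟨∑ i, g i, (Set.mem_fintype_sum _ _).2 ⟨g, hg, rfl⟩, ?_⟩
    simp [← hgy]

variable {E : Type*} [NormedAddCommGroup E] [NormedSpace ℝ E]

theorem polytopeDim_singleton (x : E) : polytopeDim ({x} : Set E) = 0 := by
  rw [polytopeDim, direction_affineSpan, vectorSpan_singleton, finrank_bot]

theorem IsLatticePolytope.isCompact {L : Submodule ℤ E} {P : Set E}
    (hP : IsLatticePolytope L P) : IsCompact P := by
  obtain ⟨S, hS, -, rfl⟩ := hP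
  exact hS.isCompact_convexHull ℝ

theorem convex_setOf_le_apply (f : Module.Dual ℝ E) (c : ℝ) : Convex ℝ {x | c ≤ f x} :=
  convex_halfSpace_ge f.isLinear c

/-- An integral linear form that is negative somewhere on a translated lattice polytope is at most
`-1` somewhere. -/
theorem IsLatticePolytope.exists_apply_le_neg_one {L : Submodule ℤ E} {P : Set E}
    (hP : IsLatticePolytope L P) {p : E} (hp : p ∈ L) {f : Module.Dual ℝ E}
    (hf : f ∈ dualLattice L) {x : E} (hx : x ∈ (fun x => x - p) '' P) (hneg : f x < 0) :
    ∃ y ∈ (fun x => x - p) '' P, f y ≤ -1 := by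
  obtain ⟨S, -, hSL, rfl⟩ := hP
  obtain ⟨z, hz, rfl⟩ := hx
  obtain ⟨s, hs, hsneg⟩ : ∃ s ∈ S, f s < f p := by
    by_contra! h
    have : f p ≤ f z := convexHull_min (t := {x | f p ≤ f x}) h (convex_setOf_le_apply f _) hz
    simp only [map_sub] at hneg
    linarith
  refine ⟨s - p, ⟨s, subset_convexHull ℝ S hs, rfl⟩, ?_⟩
  obtain ⟨n, hn⟩ := hf (s - p) (L.sub_mem (hSL hs) hp)
  have : (n : ℝ) < 0 := by rw [← hn, map_sub]; linarith
  have : n ≤ -1 := by have : n < 0 := by exact_mod_cast this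
                      omega
  rw [hn]
  exact_mod_cast this

theorem hull_eq_top_of_zero_mem_interior {P : Set E} (hP : (0 : E) ∈ interior P)
    {K : PointedCone ℝ E} (hPK : P ⊆ K) : K = ⊤ := by
  refine top_le_iff.1 fun x _ => ?_
  have ht : Filter.Tendsto (fun t : ℝ => t • x) (nhds 0) (nhds 0) :=
    (continuous_id.smul continuous_const).tendsto' 0 0 (by simp)
  have hev : ∀ᶠ t in nhdsWithin (0 : ℝ) (Set.Ioi 0), t • x ∈ P ∧ 0 < t :=
    ((ht.eventually (mem_interior_iff_mem_nhds.1 hP)).filter_mono nhdsWithin_le_nhds).and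
      self_mem_nhdsWithin
  obtain ⟨t, htP, htpos⟩ := hev.exists
  have := PointedCone.smul_mem K (inv_nonneg.2 htpos.le) (hPK htP)
  rwa [inv_smul_smul₀ htpos.ne'] at this

/-- The generators of the dual of a compact set separate every nonzero point from `0`. -/
theorem exists_apply_neg_of_dualPolytope_eq [FiniteDimensional ℝ E] {P : Set E} (hP : IsCompact P)
    {V : Set (Module.Dual ℝ E)} (hV : dualPolytope P = convexHull ℝ V) {x : E} (hx : x ≠ 0) :
    ∃ f ∈ V, f x < 0 := by
  by_contra! h
  have hdual : ∀ g ∈ dualPolytope P, 0 ≤ g x := by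
    intro g hg
    rw [hV] at hg
    exact convexHull_min (t := {g : Module.Dual ℝ E | 0 ≤ g x}) h
      (convex_halfSpace_ge (Module.Dual.eval ℝ E x).isLinear 0) hg
  have hall : ∀ f : Module.Dual ℝ E, 0 ≤ f x := by
    intro f
    obtain ⟨C, hC⟩ := hP.exists_bound_of_continuousOn
      (f := f) f.continuous_of_finiteDimensional.continuousOn
    -- A form bounded by `C` on `P` enters the dual polytope after this scaling; the summand 1
    -- avoids division by zero.
    have hpos : 0 < (|C| + 1)⁻¹ := by positivity
    have hmem : (|C| + 1)⁻¹ • f ∈ dualPolytope P := by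
      intro y hy
      have h1 := neg_le_of_abs_le (hC y hy)
      have h2 := le_abs_self C
      rw [LinearMap.smul_apply, smul_eq_mul, neg_le, ← mul_neg, inv_mul_le_iff₀ (by positivity)]
      linarith
    have := hdual _ hmem
    rw [LinearMap.smul_apply, smul_eq_mul] at this
    exact (mul_nonneg_iff_of_pos_left hpos).1 this
  refine hx ((Module.forall_dual_apply_eq_zero_iff ℝ x).1 fun f => le_antisymm ?_ (hall f))
  simpa using hall (-f)

variable {L : Submodule ℤ E} {r : ℕ} {Δ : Fin r → Set E} {p : Fin r → E}

namespace IsNefPartitionAt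

theorem zero_mem (h : IsNefPartitionAt L Δ p) (i : Fin r) : 0 ∈ (fun x => x - p i) '' Δ i :=
  ⟨p i, h.mem i, sub_self _⟩

theorem isCompact (h : IsNefPartitionAt L Δ p) (i : Fin r) :
    IsCompact ((fun x => x - p i) '' Δ i) :=
  (h.lattice i).isCompact.image (by fun_prop)

theorem exists_ne_zero (hproper : IsProper Δ) (h : IsNefPartitionAt L Δ p) (i : Fin r) :
    ∃ x ∈ (fun x => x - p i) '' Δ i, x ≠ 0 := by
  by_contra! hz
  have hs : Δ i = {p i} := Set.eq_singleton_iff_unique_mem.2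
    ⟨h.mem i, fun x hx => sub_eq_zero.1 (hz _ ⟨x, hx, rfl⟩)⟩
  have := hproper i
  rw [hs, polytopeDim_singleton] at this
  exact this.false

/-- A lattice generator of the dual polytope is negative on at most one of the translated
summands. -/
theorem nonneg_of_neg (h : IsNefPartitionAt L Δ p) {f : Module.Dual ℝ E}
    (hfL : f ∈ dualLattice L) (hf : f ∈ dualPolytope ((fun x => x - ∑ i, p i) '' (∑ i, Δ i)))
    {i j : Fin r} (hij : j ≠ i) {x y : E} (hx : x ∈ (fun x => x - p i) '' Δ i) (hfx : f x < 0)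
    (hy : y ∈ (fun x => x - p j) '' Δ j) : 0 ≤ f y := by
  by_contra! hfy
  obtain ⟨s, hs, hfs⟩ := (h.lattice i).exists_apply_le_neg_one (h.mem_lattice i) hfL hx hfx
  obtain ⟨t, ht, hft⟩ := (h.lattice j).exists_apply_le_neg_one (h.mem_lattice j) hfL hy hfy
  -- The remaining summands contribute 0, so `s + t` lies in the sum, where `f ≥ -1`; but `f (s + t)
  -- ≤ -2`.
  have hmem : s + t ∈ (fun x => x - ∑ i, p i) '' (∑ i, Δ i) := by
    refine mem_translated_sum_iff.2 ⟨Pi.single i s + Pi.single j t, fun k => ?_, ?_⟩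
    · by_cases hki : k = i
      · subst hki; simpa [hij.symm] using hs
      · by_cases hkj : k = j
        · subst hkj; simpa [hij] using ht
        · simpa [hki, hkj] using h.zero_mem k
    · simp [Finset.sum_add_distrib]
  have := hf _ hmem
  rw [map_add] at this
  linarith

theorem exists_isIrredundant [FiniteDimensional ℝ E] (h : IsNefPartitionAt L Δ p)
    (hproper : IsProper Δ) : ∃ v, IsIrredundant (fun i => (fun x => x - p i) '' Δ i) v := by
  obtain ⟨V, -, hVL, hV⟩ := h.reflexive.reflexive.lattice_dual
  have hsep : ∀ i, ∃ x ∈ (fun x => x - p i) '' Δ i, ∃ f ∈ V, f x < 0 := by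
    intro i
    obtain ⟨x, hx, hx0⟩ := h.exists_ne_zero hproper i
    exact ⟨x, hx, exists_apply_neg_of_dualPolytope_eq h.reflexive.reflexive.lattice.isCompact hV hx0⟩
  choose x hx v hvV hv using hsep
  refine ⟨v, ?_, fun i j hij y hy => ?_, fun i hi => ?_⟩
  · refine hull_eq_top_of_zero_mem_interior h.reflexive.reflexive.zero_mem_interior fun z hz => ?_
    obtain ⟨y, hy, rfl⟩ := mem_translated_sum_iff.1 hz
    exact Submodule.sum_mem _ fun i _ =>
      PointedCone.subset_hull (Set.mem_iUnion.2 ⟨i, hy i⟩)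
  · exact h.nonneg_of_neg (hVL (hvV i)) (hV ▸ subset_convexHull ℝ V (hvV i)) hij (hx i) (hv i) hy
  · have := hv i
    simp [hi] at this

end IsNefPartitionAt

end NefPartition

end Nef

theorem mainTheorem9 {E : Type*} [NormedAddCommGroup E] [NormedSpace ℝ E] [FiniteDimensional ℝ E]
    (L : Submodule ℤ E) [DiscreteTopology L] [IsZLattice ℝ L]
    {r : ℕ} (Δ : Fin r → Set E) (hΔ : Nef.IsNefPartition L Δ) (hproper : Nef.IsProper Δ) :
    r ≤ 2 * Module.finrank ℝ E ∧
      (r = 2 * Module.finrank ℝ E →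
        ∀ p : Fin r → E, Nef.IsNefPartitionAt L Δ p →
          Nef.CombEquiv (convexHull ℝ (⋃ i, (fun x => x - p i) '' Δ i))
            (Nef.crossPolytope (Module.finrank ℝ E))) := by
  constructor
  · obtain ⟨p, hp⟩ := hΔ
    obtain ⟨v, hv⟩ := hp.exists_isIrredundant hproper
    simpa using hv.card_le
  · intro hr p hp
    obtain ⟨v, hv⟩ := hp.exists_isIrredundant hproper
    -- The convention `r ≥ 1` matters here: it excludes `r = 2d = 0`, where the union would be
    -- empty.
    have : Nonempty (Fin r) := ⟨⟨0, hp.length_pos⟩⟩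
    obtain ⟨b, α, β, hα, hβ, heq⟩ :=
      hv.exists_convexHull_eq_skewCrossPolytope (by simpa using hr) hp.zero_mem hp.isCompact
    rw [heq, Nef.crossPolytope_eq]
    exact Nef.combEquiv_skewCrossPolytope hα hβ b _
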